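/- Notation. For integers $m\ge 0$ and $p\ge 0$ let $[m]=\{1,\dots,m\}$, and let $[m]^{\leq p}$ be the simplicial complex of all subsets of $[m]$ with at most $p$ elements (the empty set counts as a simplex, and an element of the ground set need not be a vertex). For a simplicial complex $K\subset 2^{[m]}$ let $K^\circ=\{A\subset[m] : [m]\setminus A\notin K\}$ be its Alexander dual, and let $Bier_m(K)=\{A\sqcup B : A\in K,\ B\in K^\circ,\ A\cap B=\emptyset\}$, a complex on the disjoint union of two copies of $[m]$. For non-negative integers $k_1,\dots,k_n$ and $l_1,\dots,l_m$ let $\Delta_{m,n}^{k_1,\dots,k_n;\,l_1,\dots,l_m}$ be the complex of all $A\subset[m]\times[n]$ such that $|\{a : (a,i)\in A\}|\le k_i$ for all $i\in[n]$ (at most $k_i$ rooks in the $i$-th row) and $|\{b : (j,b)\in A\}|\le l_j$ for all $j\in[m]$ (at most $l_j$ rooks in the $j$-th column). When $l_1=\dots=l_m=1$ write $\Delta_{m,n}^{k_1,\dots,k_n;\mathbf 1}$; when all $k_i=p$ and all $l_j=q$ write $\Delta_{m,n}^{p,q}$; and for a set $R\subset[n]$ of $j$ rows, $\Delta_{m,n}^{p,1(j)}$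 denotes the complex with $k_i=p$ for $i\in R$, $k_i=1$ for $i\notin R$, and all $l_j=1$. The sphere $S^d$ is the unit sphere of $\mathbb R^{d+1}$, with $S^{-1}=\emptyset$. Between complexes $\cong$ means simplicial isomorphism; between a complex and a sphere it means that the geometric realization of the complex is homeomorphic to the sphere. **Proposition 1.6.** Let $0\le p<m$ be integers. Then $$S^{m-2}\cong Bier_m([m]^{\leq p})\cong\Delta_{m,2}^{p,\,m-p-1;\,\mathbf 1}$$ (so $\Delta_{m,2}^{p,\,m-p-1;\,\mathbf 1}\cong S^{m-2}$ as well). In particular, for every $p\ge 0$, $$\Delta_{2p+1,2}^{p,1}\cong Bier_{2p+1}([2p+1]^{\leq p})\cong S^{2p-1},$$ and, for every $m\ge 2$ and every choice of one of the two rows as the selected row, $$\Delta_{m,2}^{m-2,1(1)}\cong Bier_m([m]^{\leq 1})\cong S^{m-2};$$ thus $\Delta_{2p+1,2}^{p,1}\cong S^{2p-1}$ and $\Delta_{m,2}^{m-2,1(1)}\cong S^{m-2}$. -/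

import Mathlib

namespace BierChess

/-- A simplicial complex on the vertex set `V`, in the sense of a family of finite subsets of `V`
(the simplices) which is closed under passing to subsets. As usual in combinatorics the empty set
is a simplex (of every complex that is not void), and an element of `V` need not
be a vertex of the complex. -/
abbrev Complex (V : Type*) := LowerSet (Finset V)

namespace Complex

/-- The vertices of `K`: the elements `v` for which `{v}` is a simplex. -/
abbrev Vertex {V : Type*} (K : Complex V) : Type _ := {v : V // {v} ∈ K}

/-- Isomorphism of simplicial complexes: a bijection between the vertices under which simplices
correspond to simplices, in both directions. -/
def Isomorphic {V W : Type*} (K : Complex V) (L : Complex W) : Prop :=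
  ∃ e : K.Vertex ≃ L.Vertex, ∀ s : Finset K.Vertex,
    s.map (Function.Embedding.subtype _) ∈ K ↔
      (s.map e.toEmbedding).map (Function.Embedding.subtype _) ∈ L

/-- The geometric realization of a complex on a finite set `V`, as a subspace of `V → ℝ`: the union
of the faces of the standard simplex that are spanned by the simplices of `K`. -/
def realization {V : Type*} [Fintype V] (K : Complex V) : Set (V → ℝ) :=
  {x | x ∈ stdSimplex ℝ V ∧ ∃ s ∈ K, ∀ v, v ∉ s → x v = 0}

/-- The realization of `K` is homeomorphic to the unit sphere of `ℝⁿ`, the sphere of dimension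
`n - 1` (for `n = 0` this is the empty set, the sphere of dimension `-1`). -/
def HomeomorphicToUnitSphere {V : Type*} [Fintype V] (K : Complex V) (n : ℕ) : Prop :=
  Nonempty (K.realization ≃ₜ Metric.sphere (0 : EuclideanSpace ℝ (Fin n)) 1)

/-- The complex `[m]^{≤ p}` of all subsets of an `m`-element set that have at most `p` elements. -/
def sizeAtMost (m p : ℕ) : Complex (Fin m) where
  carrier := {s | s.card ≤ p}
  lower' := fun _ _ hts hs => (Finset.card_le_card hts).trans hs

/-- The combinatorial Alexander dual: the sets whose complement is not a simplex of `K`. -/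
def alexanderDual {V : Type*} [Fintype V] [DecidableEq V] (K : Complex V) : Complex V where
  carrier := {s | sᶜ ∉ K}
  lower' := fun _ _ hts hs ht => hs (K.lower (Finset.compl_subset_compl.mpr hts) ht)

/-- The disjoint join of two complexes on `V`: its vertices lie in two copies of `V`, its simplices
are the disjoint unions `s ⊔ t` with `s ∈ K` in the first copy and `t ∈ L` in the second copy,
where `s` and `t` are disjoint as subsets of `V`. -/
def disjointJoin {V : Type*} (K L : Complex V) : Complex (V ⊕ V) where
  carrier := {u | u.toLeft ∈ K ∧ u.toRight ∈ L ∧ Disjoint u.toLeft u.toRight}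
  lower' := fun _ _ hts hs =>
    ⟨K.lower (Finset.toLeft_subset_toLeft hts) hs.1,
      L.lower (Finset.toRight_subset_toRight hts) hs.2.1,
      hs.2.2.mono (Finset.toLeft_subset_toLeft hts) (Finset.toRight_subset_toRight hts)⟩

/-- The Bier sphere of `K`: the disjoint join of `K` and its Alexander dual. -/
def bier {V : Type*} [Fintype V] [DecidableEq V] (K : Complex V) : Complex (V ⊕ V) :=
  disjointJoin K (alexanderDual K)

/-- The generalized chessboard complex `Δ_{m,n}^{k;l}`: all rook placements on the board
`[m] × [n]` with at most `k i` rooks in the `i`-th row (the squares with second coordinate `i`) and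
at most `l j` rooks in the `j`-th column (the squares with first coordinate `j`). -/
def chessboard (m n : ℕ) (k : Fin n → ℕ) (l : Fin m → ℕ) : Complex (Fin m × Fin n) where
  carrier := {A | (∀ i, (A.filter fun a => a.2 = i).card ≤ k i) ∧
    ∀ j, (A.filter fun a => a.1 = j).card ≤ l j}
  lower' := fun _ _ hts hs =>
    ⟨fun i => (Finset.card_le_card (Finset.filter_subset_filter _ hts)).trans (hs.1 i),
      fun j => (Finset.card_le_card (Finset.filter_subset_filter _ hts)).trans (hs.2 j)⟩

/-- The complex `Δ_{m,n}^{p,q}`: at most `p` rooks in each row, at most `q` in each column. -/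
def chessboardConst (m n p q : ℕ) : Complex (Fin m × Fin n) :=
  chessboard m n (fun _ => p) (fun _ => q)

/-- The complex `Δ_{m,n}^{p,1(j)}`, where the `j` selected rows form the set `R`: at most `p` rooks
in each row of `R`, at most one rook in every other row and in every column. -/
def chessboardSelected (m n p : ℕ) (R : Finset (Fin n)) : Complex (Fin m × Fin n) :=
  chessboard m n (fun i => if i ∈ R then p else 1) (fun _ => 1)

end Complex

end BierChess

/-! The Alexander dual of `[m]^{≤ p}` is `[m]^{≤ m-p-1}`, so the Bier complex is a two-row
chessboard complex: the copies of `[m]` are the rows, and disjointness is the bound of one rook per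
column (`mem_bier_iff_map_mem_chessboard`).

For the sphere, send a point `(x, y)` of the realization to `z = x - y`. Disjoint supports make `x`
and `y` the positive and negative parts of `z`, so the realization becomes the set of `z` of ℓ¹-norm
1 with at most `p` positive and at most `m-p-1` negative coordinates (`mem_realization_bier_iff`).
Without the norm condition these `z` form a cone that meets each line parallel to the diagonal
exactly once: shift the `(p+1)`-st largest coordinate to 0. Hence every ray of `ℝᵐ` modulo the
diagonal contains the image of exactly one point (`exists_diffs_eq_smul`, `eq_of_diffs_eq_smul`),
and radial projection is a continuous bijection from a compact space onto the sphere. -/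

namespace BierChess.Complex

open Finset

/-! ### Relabelling the ground set -/

section Transport

variable {V W : Type*}

/-- Relabelling the ground set along `e` gives an isomorphism of complexes. -/
theorem isomorphic_of_equiv {K : Complex V} {L : Complex W} (e : V ≃ W)
    (h : ∀ s, s ∈ K ↔ s.map e.toEmbedding ∈ L) : Isomorphic K L := by
  refine ⟨e.subtypeEquiv fun v => ?_, fun s => ?_⟩
  · simpa using h {v}
  · rw [h, map_map, map_map]
    rfl

theorem Isomorphic.symm {K : Complex V} {L : Complex W} (h : Isomorphic K L) :
    Isomorphic L K := by
  obtain ⟨e, he⟩ := h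
  refine ⟨e.symm, fun s => ?_⟩
  rw [he, map_map (f := e.symm.toEmbedding)]
  simp

variable [Fintype V] [Fintype W]

theorem mem_realization_comp {K : Complex V} {L : Complex W} (e : V ≃ W)
    (h : ∀ s, s ∈ K ↔ s.map e.toEmbedding ∈ L) (x : W → ℝ) :
    x ∈ L.realization ↔ x ∘ e ∈ K.realization := by
  have hsum : ∑ v, x (e v) = ∑ w, x w := e.sum_comp x
  constructor
  · rintro ⟨⟨h0, h1⟩, s, hs, hx⟩
    refine ⟨⟨fun v => h0 _, hsum.trans h1⟩, s.map e.symm.toEmbedding, ?_, fun v hv => hx _ ?_⟩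
    · rw [h, map_map]
      simpa using hs
    · simpa [Equiv.symm_apply_eq] using hv
  · rintro ⟨⟨h0, h1⟩, s, hs, hx⟩
    refine ⟨⟨fun w => by simpa using h0 (e.symm w), hsum.symm.trans h1⟩,
      s.map e.toEmbedding, (h s).1 hs, fun w hw => ?_⟩
    have := hx (e.symm w) fun hv => hw (mem_map.2 ⟨_, hv, by simp⟩)
    simpa using this

theorem HomeomorphicToUnitSphere.of_equiv {K : Complex V} {L : Complex W} (e : V ≃ W)
    (h : ∀ s, s ∈ K ↔ s.map e.toEmbedding ∈ L) {n : ℕ} (hK : K.HomeomorphicToUnitSphere n) :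
    L.HomeomorphicToUnitSphere n := by
  obtain ⟨f⟩ := hK
  refine ⟨Homeomorph.trans (Homeomorph.subtype (Homeomorph.piCongrLeft (Y := fun _ => ℝ) e).symm
    fun x => ?_) f⟩
  rw [mem_realization_comp e h]
  rfl

end Transport

/-! ### The Bier complex as a two-row chessboard -/

theorem mem_bier_sizeAtMost {m p : ℕ} (hp : p < m) {u : Finset (Fin m ⊕ Fin m)} :
    u ∈ (sizeAtMost m p).bier ↔
      u.toLeft.card ≤ p ∧ u.toRight.card ≤ m - p - 1 ∧ Disjoint u.toLeft u.toRight := by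
  change u.toLeft.card ≤ p ∧ ¬ (u.toRightᶜ.card ≤ p) ∧ _ ↔ _
  rw [card_compl, Fintype.card_fin]
  have := card_le_univ u.toRight
  rw [Fintype.card_fin] at this
  refine and_congr_right fun _ => and_congr_left fun _ => ?_
  omega

/-- Two copies of `[m]` as the board `[m] × [2]`, the first copy being the row `i`. -/
def boardEquiv (m : ℕ) (i : Fin 2) : Fin m ⊕ Fin m ≃ Fin m × Fin 2 where
  toFun := Sum.elim (fun j => (j, i)) (fun j => (j, i + 1))
  invFun a := if a.2 = i then .inl a.1 else .inr a.1
  left_inv := by rintro (j | j) <;> simp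
  right_inv := by
    rintro ⟨j, r⟩
    fin_cases i <;> fin_cases r <;> simp

theorem mem_bier_iff_map_mem_chessboard {m p : ℕ} (hp : p < m) {k : Fin 2 → ℕ} {i : Fin 2}
    (hi : k i = p) (hi' : k (i + 1) = m - p - 1) (u : Finset (Fin m ⊕ Fin m)) :
    u ∈ (sizeAtMost m p).bier ↔
      u.map (boardEquiv m i).toEmbedding ∈ chessboard m 2 k (fun _ => 1) := by
  have hl : ((u.map (boardEquiv m i).toEmbedding).filter fun a => a.2 = i).card =
      u.toLeft.card := by
    rw [← card_map (s := u.toLeft) ⟨fun j => (j, i), fun a b h => (Prod.ext_iff.1 h).1⟩]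
    refine congrArg card ?_
    ext ⟨j, r⟩
    fin_cases i <;> fin_cases r <;> simp [boardEquiv]
  have hr : ((u.map (boardEquiv m i).toEmbedding).filter fun a => a.2 = i + 1).card =
      u.toRight.card := by
    rw [← card_map (s := u.toRight) ⟨fun j => (j, i + 1), fun a b h => (Prod.ext_iff.1 h).1⟩]
    refine congrArg card ?_
    ext ⟨j, r⟩
    fin_cases i <;> fin_cases r <;> simp [boardEquiv]
  have hrows : ∀ P : Fin 2 → Prop, (∀ r, P r) ↔ P i ∧ P (i + 1) := by
    intro P
    fin_cases i <;> simp [Fin.forall_fin_two, and_comm]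
  have hcol : (∀ j, ((u.map (boardEquiv m i).toEmbedding).filter fun a => a.1 = j).card ≤ 1) ↔
      Disjoint u.toLeft u.toRight := by
    simp only [card_le_one, mem_filter, mem_map, disjoint_left, mem_toLeft, mem_toRight]
    constructor
    · intro h j h1 h2
      have := h j (j, i) ⟨⟨_, h1, rfl⟩, rfl⟩ (j, i + 1) ⟨⟨_, h2, rfl⟩, rfl⟩
      simp at this
    · rintro h j _ ⟨⟨a | a, ha, rfl⟩, rfl⟩ _ ⟨⟨b | b, hb, rfl⟩, hab⟩
      all_goals
        obtain rfl : b = a := hab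
        first
        | rfl
        | exact absurd hb (h ha)
        | exact absurd ha (h hb)
  rw [mem_bier_sizeAtMost hp, ← hcol, ← and_assoc]
  change _ ↔ (∀ r, _) ∧ ∀ j, _
  rw [hrows, hl, hr, hi, hi']

/-! ### Signed coordinates modulo the diagonal -/

section Sphere

variable {n p : ℕ}

/-- An order statistic: at most `p` values lie above it and at most `n - p` lie below it. -/
theorem exists_card_lt_le_card_gt_le (hp : p ≤ n) (w : Fin (n + 1) → ℝ) :
    ∃ c, #{i | c < w i} ≤ p ∧ #{i | w i < c} ≤ n - p := by
  have hmono := Tuple.monotone_sort w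
  set σ := Tuple.sort w
  -- In increasing order, `n - p` positions precede this one and `p` follow it.
  let a : Fin (n + 1) := ⟨n - p, by omega⟩
  refine ⟨w (σ a), ?_, ?_⟩
  · calc #{i | w (σ a) < w i} ≤ #((Ioi a).map σ.toEmbedding) := by
          refine card_le_card fun i hi => ?_
          refine mem_map.2 ⟨σ.symm i, mem_Ioi.2 (lt_of_not_ge fun h => ?_), by simp⟩
          have := hmono h
          simp only [Function.comp, Equiv.apply_symm_apply] at this
          exact absurd (mem_filter.1 hi).2 this.not_gt
      _ ≤ p := by
          rw [card_map, Fin.card_Ioi]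
          simp only [a]
          omega
  · calc #{i | w i < w (σ a)} ≤ #((Iio a).map σ.toEmbedding) := by
          refine card_le_card fun i hi => ?_
          refine mem_map.2 ⟨σ.symm i, mem_Iio.2 (lt_of_not_ge fun h => ?_), by simp⟩
          have := hmono h
          simp only [Function.comp, Equiv.apply_symm_apply] at this
          exact absurd (mem_filter.1 hi).2 this.not_gt
      _ ≤ n - p := by
          rw [card_map, Fin.card_Iio]

/-- A vector with at most `n - p` negative coordinates has more than `p` positive ones
after any shift by a positive constant. -/
theorem const_nonpos_of_card_le (hp : p ≤ n) {z z' : Fin (n + 1) → ℝ} {c : ℝ}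
    (hz : #{i | 0 < z i} ≤ p) (hz' : #{i | z' i < 0} ≤ n - p) (h : ∀ i, z i = z' i + c) :
    c ≤ 0 := by
  by_contra! hc
  -- Where `z'` is nonnegative, `z` is at least `c > 0`; so two sets of total size at most `n` would
  -- cover `n + 1` indices.
  have : (univ : Finset (Fin (n + 1))) ⊆
      ({i | 0 < z i} : Finset (Fin (n + 1))) ∪
        ({i | z' i < 0} : Finset (Fin (n + 1))) := by
    intro i _
    rw [mem_union, mem_filter_univ, mem_filter_univ, h]
    by_cases hi : z' i < 0
    · exact .inr hi
    · exact .inl (by linarith)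
  have := (card_le_card this).trans (card_union_le _ _)
  rw [card_univ, Fintype.card_fin] at this
  omega

/-- The difference of the two halves of a vector. -/
def signed {V : Type*} (x : V ⊕ V → ℝ) (i : V) : ℝ := x (.inl i) - x (.inr i)

theorem mem_realization_bier_iff (hp : p ≤ n) (x : Fin (n + 1) ⊕ Fin (n + 1) → ℝ) :
    x ∈ (sizeAtMost (n + 1) p).bier.realization ↔
      (∀ i, x (.inl i) = max (signed x i) 0) ∧ (∀ i, x (.inr i) = max (-signed x i) 0) ∧
      ∑ i, |signed x i| = 1 ∧ #{i | 0 < signed x i} ≤ p ∧ #{i | signed x i < 0} ≤ n - p := by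
  have hpn : p < n + 1 := by omega
  have hq : n + 1 - p - 1 = n - p := by omega
  constructor
  · rintro ⟨⟨h0, h1⟩, s, hs, hx⟩
    rw [mem_bier_sizeAtMost hpn, hq] at hs
    obtain ⟨hl, hr, hd⟩ := hs
    have hor (i) : x (.inl i) = 0 ∨ x (.inr i) = 0 := by
      by_contra! h
      exact disjoint_left.1 hd (mem_toLeft.2 (by_contra fun hi => h.1 (hx _ hi)))
        (mem_toRight.2 (by_contra fun hi => h.2 (hx _ hi)))
    have hmax (i) : x (.inl i) = max (signed x i) 0 := by
      have hli := h0 (.inl i)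
      have hri := h0 (.inr i)
      rcases hor i with h | h <;> simp [signed, h, hli, hri]
    have hmax' (i) : x (.inr i) = max (-signed x i) 0 := by
      have hli := h0 (.inl i)
      have hri := h0 (.inr i)
      rcases hor i with h | h <;> simp [signed, h, hli, hri]
    refine ⟨hmax, hmax', ?_, (card_le_card fun i hi => ?_).trans hl,
      (card_le_card fun i hi => ?_).trans hr⟩
    · rw [← h1, Fintype.sum_sum_type, ← sum_add_distrib]
      refine sum_congr rfl fun i _ => ?_
      have hli := h0 (.inl i)
      have hri := h0 (.inr i)
      rcases hor i with h | h <;> simp [signed, h, hli, hri]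
    · rw [mem_filter_univ] at hi
      refine mem_toLeft.2 (by_contra fun h => ?_)
      have := hmax i
      rw [hx _ h, max_eq_left hi.le] at this
      exact hi.ne this
    · rw [mem_filter_univ] at hi
      refine mem_toRight.2 (by_contra fun h => ?_)
      have := hmax' i
      rw [hx _ h, max_eq_left (by linarith)] at this
      linarith
  · rintro ⟨hl, hr, h1, hpos, hneg⟩
    refine ⟨⟨?_, ?_⟩, ({i | 0 < signed x i} : Finset _).disjSum {i | signed x i < 0}, ?_, ?_⟩
    · rintro (i | i)
      · rw [hl]
        exact le_max_right _ _
      · rw [hr]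
        exact le_max_right _ _
    · rw [← h1, Fintype.sum_sum_type, ← sum_add_distrib]
      refine sum_congr rfl fun i _ => ?_
      rw [hl, hr]
      rcases le_total 0 (signed x i) with h | h
      · rw [max_eq_left h, max_eq_right (by linarith), abs_of_nonneg h, add_zero]
      · rw [max_eq_right h, max_eq_left (by linarith), abs_of_nonpos h, zero_add]
    · rw [mem_bier_sizeAtMost hpn, hq]
      refine ⟨by simpa using hpos, by simpa using hneg, ?_⟩
      rw [disjoint_left]
      intro i hi hi'
      simp only [toLeft_disjSum, toRight_disjSum, mem_filter_univ] at hi hi'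
      exact hi.not_gt hi'
    · rintro (i | i) hi
      · rw [hl]
        simpa using hi
      · rw [hr]
        simpa using hi

/-- The linear map sending `(x, y)` to the differences of the coordinates of `z = x - y`,
which identifies `ℝⁿ⁺¹` modulo the diagonal with `ℝⁿ`. -/
noncomputable def diffs (x : Fin (n + 1) ⊕ Fin (n + 1) → ℝ) : EuclideanSpace ℝ (Fin n) :=
  WithLp.toLp 2 fun i => signed x i.succ - signed x 0

theorem continuous_diffs : Continuous (diffs (n := n)) := by
  unfold diffs signed
  fun_prop

/-- Injectivity on rays: the signed vectors agree up to the factor `r` and a constant shift. The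
sign counts force the shift to be 0, then the ℓ¹-norms force `r = 1`. -/
theorem eq_of_diffs_eq_smul (hp : p ≤ n) {x y : Fin (n + 1) ⊕ Fin (n + 1) → ℝ}
    (hx : x ∈ (sizeAtMost (n + 1) p).bier.realization)
    (hy : y ∈ (sizeAtMost (n + 1) p).bier.realization) {r : ℝ} (hr : 0 < r)
    (h : diffs x = r • diffs y) : x = y := by
  rw [mem_realization_bier_iff hp] at hx hy
  obtain ⟨hxl, hxr, hx1, hxp, hxn⟩ := hx
  obtain ⟨hyl, hyr, hy1, hyp, hyn⟩ := hy
  have hc : ∀ i, signed x i = r * signed y i + (signed x 0 - r * signed y 0) := by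
    refine Fin.cases (by ring) fun i => ?_
    have := congrArg (fun v : EuclideanSpace ℝ (Fin n) => v i) h
    simp only [diffs, PiLp.smul_apply, smul_eq_mul] at this
    linarith
  set c := signed x 0 - r * signed y 0
  -- The shift bound is applied in both directions, with the two vectors exchanged.
  have hc0 : c = 0 := by
    refine le_antisymm (const_nonpos_of_card_le hp hxp ?_ hc) ?_
    · simpa [mul_neg_iff, hr, hr.not_gt] using hyn
    · have := const_nonpos_of_card_le hp (z := fun i => r * signed y i) (z' := signed x)
        (c := -c) ?_ hxn fun i => by rw [hc i]; ring
      · linarith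
      · simpa [mul_pos_iff, hr, hr.not_gt] using hyp
  have hr1 : r = 1 := by
    have : ∑ i, |signed x i| = r * ∑ i, |signed y i| := by
      rw [mul_sum]
      refine sum_congr rfl fun i _ => ?_
      rw [hc i, hc0, add_zero, abs_mul, abs_of_pos hr]
    rw [hx1, hy1] at this
    linarith
  have hxy (i) : signed x i = signed y i := by rw [hc i, hc0, hr1]; ring
  ext (i | i)
  · rw [hxl, hyl, hxy]
  · rw [hxr, hyr, hxy]

/-- A constant vector obeying both sign counts is 0, against ℓ¹-norm 1. For `n = 0` this says that
the realization is empty, as `S⁻¹` requires. -/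
theorem diffs_ne_zero (hp : p ≤ n) {x : Fin (n + 1) ⊕ Fin (n + 1) → ℝ}
    (hx : x ∈ (sizeAtMost (n + 1) p).bier.realization) : diffs x ≠ 0 := by
  intro h
  rw [mem_realization_bier_iff hp] at hx
  obtain ⟨-, -, h1, hpos, hneg⟩ := hx
  have hc : ∀ i, signed x i = signed x 0 := by
    refine Fin.cases rfl fun i => ?_
    have := congrArg (fun v : EuclideanSpace ℝ (Fin n) => v i) h
    simp only [diffs, PiLp.zero_apply] at this
    linarith
  have h0 : signed x 0 = 0 := by
    refine le_antisymm ?_ ?_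
    · exact const_nonpos_of_card_le hp (z' := 0) hpos (by simp) fun i => by simp [hc i]
    · have := const_nonpos_of_card_le hp (z := 0) (c := -signed x 0) (by simp) hneg
        fun i => by simp [hc i]
      linarith
  simp [hc, h0] at h1

theorem exists_diffs_eq_smul (hp : p ≤ n) {w : EuclideanSpace ℝ (Fin n)} (hw : w ≠ 0) :
    ∃ x ∈ (sizeAtMost (n + 1) p).bier.realization, ∃ r : ℝ, 0 < r ∧ diffs x = r • w := by
  -- Prepending 0 lifts `w` to a vector whose differences are `w`; subtracting the order statistic
  -- `c` gives the sign counts without changing them.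
  obtain ⟨c, hpos, hneg⟩ := exists_card_lt_le_card_gt_le hp (Fin.cons 0 w.ofLp)
  set z : Fin (n + 1) → ℝ := fun i => (Fin.cons 0 w.ofLp : Fin (n + 1) → ℝ) i - c with hz
  have hN : 0 < ∑ i, |z i| := by
    refine (sum_nonneg fun i _ => abs_nonneg _).lt_of_ne' fun h => hw ?_
    have h0 (i) : z i = 0 := by
      simpa using (sum_eq_zero_iff_of_nonneg fun i _ => abs_nonneg (z i)).1 h i (mem_univ i)
    ext i
    have h1 := h0 0
    have h2 := h0 i.succ
    simp only [hz, Fin.cons_zero, Fin.cons_succ] at h1 h2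
    simp only [PiLp.zero_apply]
    linarith
  set r := (∑ i, |z i|)⁻¹ with hr
  have hr0 : 0 < r := inv_pos.2 hN
  let x : Fin (n + 1) ⊕ Fin (n + 1) → ℝ :=
    Sum.elim (fun i => max (r * z i) 0) (fun i => max (-(r * z i)) 0)
  have hs (i) : signed x i = r * z i := by
    simpa [signed, x, max_comm] using max_zero_sub_max_neg_zero_eq_self (r * z i)
  refine ⟨x, (mem_realization_bier_iff hp x).2 ⟨?_, ?_, ?_, ?_, ?_⟩, r, hr0, ?_⟩
  · intro i
    rw [hs]
    rfl
  · intro i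
    rw [hs]
    rfl
  · simp only [hs, abs_mul, abs_of_pos hr0, ← mul_sum]
    exact inv_mul_cancel₀ hN.ne'
  · simpa [hs, mul_pos_iff, hr0, hr0.not_gt, hz] using hpos
  · simpa [hs, mul_neg_iff, hr0, hr0.not_gt, hz] using hneg
  · ext i
    simp only [diffs, hs, hz, Fin.cons_zero, Fin.cons_succ, PiLp.smul_apply, smul_eq_mul]
    ring

end Sphere

/-! ### Radial projection and the homeomorphism -/

theorem isCompact_realization {V : Type*} [Fintype V] (K : Complex V) :
    IsCompact K.realization := by
  have : K.realization = ⋃ s ∈ {s | s ∈ K}, stdSimplex ℝ V ∩ ⋂ v ∈ {v | v ∉ s}, {x | x v = 0} := by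
    ext x
    simp [realization]
  rw [this]
  refine (Set.toFinite _).isCompact_biUnion fun s _ => (isCompact_stdSimplex ℝ V).inter_right ?_
  exact isClosed_biInter fun v _ => isClosed_eq (continuous_apply v) continuous_const

/-- The Bier sphere of `[m]^{≤ p}` is a sphere: the radial projection of its realization,
placed in `ℝᵐ` modulo the diagonal, is a bijection onto the unit sphere. -/
theorem homeomorphicToUnitSphere_bier_sizeAtMost {m p : ℕ} (hp : p < m) :
    (sizeAtMost m p).bier.HomeomorphicToUnitSphere (m - 1) := by
  obtain ⟨n, rfl⟩ : ∃ n, m = n + 1 := ⟨m - 1, by omega⟩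
  have hpn : p ≤ n := by omega
  rw [Nat.add_sub_cancel]
  set X := (sizeAtMost (n + 1) p).bier.realization
  have : CompactSpace X := isCompact_iff_compactSpace.1 (isCompact_realization _)
  have hne (x : X) : 0 < ‖diffs x.1‖ := norm_pos_iff.2 (diffs_ne_zero hpn x.2)
  let f : X → Metric.sphere (0 : EuclideanSpace ℝ (Fin n)) 1 := fun x =>
    ⟨‖diffs x.1‖⁻¹ • diffs x.1, by simp [norm_smul, (hne x).ne']⟩
  have hd : Continuous fun x : X => diffs x.1 := continuous_diffs.comp continuous_subtype_val
  have hf : Continuous f :=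
    ((hd.norm.inv₀ fun x => (hne x).ne').smul hd).subtype_mk _
  have hbij : Function.Bijective f := by
    constructor
    · intro x y hxy
      have h := congrArg Subtype.val hxy
      refine Subtype.ext (eq_of_diffs_eq_smul hpn x.2 y.2
        (mul_pos (hne x) (inv_pos.2 (hne y))) ?_)
      rw [mul_smul]
      exact (inv_smul_eq_iff₀ (hne x).ne').1 h
    · rintro ⟨w, hw⟩
      rw [mem_sphere_zero_iff_norm] at hw
      obtain ⟨x, hx, r, hr, hxr⟩ := exists_diffs_eq_smul hpn (w := w) (by
        rintro rfl
        simp at hw)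
      refine ⟨⟨x, hx⟩, Subtype.ext ?_⟩
      simp [f, hxr, norm_smul, hw, abs_of_pos hr, smul_smul, hr.ne']
  exact ⟨hf.homeoOfEquivCompactToT2 (f := Equiv.ofBijective f hbij)⟩

/-- The Bier sphere of `[m]^{≤ p}` is the chessboard complex on two rows, in either order,
with capacities `p` and `m - p - 1`. -/
theorem isomorphic_bier_chessboard {m p : ℕ} (hp : p < m) {k : Fin 2 → ℕ} (i : Fin 2)
    (hi : k i = p) (hi' : k (i + 1) = m - p - 1) :
    Isomorphic (sizeAtMost m p).bier (chessboard m 2 k fun _ => 1) :=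
  isomorphic_of_equiv (boardEquiv m i) (mem_bier_iff_map_mem_chessboard hp hi hi')

theorem homeomorphicToUnitSphere_chessboard {m p : ℕ} (hp : p < m) {k : Fin 2 → ℕ} (i : Fin 2)
    (hi : k i = p) (hi' : k (i + 1) = m - p - 1) :
    (chessboard m 2 k fun _ => 1).HomeomorphicToUnitSphere (m - 1) :=
  (homeomorphicToUnitSphere_bier_sizeAtMost hp).of_equiv (boardEquiv m i)
    (mem_bier_iff_map_mem_chessboard hp hi hi')

end BierChess.Complex

theorem proposition1p6 :
    (∀ m p : ℕ, p < m →
      (BierChess.Complex.sizeAtMost m p).bier.HomeomorphicToUnitSphere (m - 1) ∧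
      BierChess.Complex.Isomorphic (BierChess.Complex.sizeAtMost m p).bier
        (BierChess.Complex.chessboard m 2 ![p, m - p - 1] (fun _ => 1)) ∧
      (BierChess.Complex.chessboard m 2 ![p, m - p - 1]
        (fun _ => 1)).HomeomorphicToUnitSphere (m - 1)) ∧
    (∀ p : ℕ,
      BierChess.Complex.Isomorphic (BierChess.Complex.chessboardConst (2 * p + 1) 2 p 1)
        (BierChess.Complex.sizeAtMost (2 * p + 1) p).bier ∧
      (BierChess.Complex.sizeAtMost (2 * p + 1) p).bier.HomeomorphicToUnitSphere (2 * p) ∧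
      (BierChess.Complex.chessboardConst (2 * p + 1) 2 p 1).HomeomorphicToUnitSphere (2 * p)) ∧
    (∀ (m : ℕ) (R : Finset (Fin 2)), 2 ≤ m → R.card = 1 →
      BierChess.Complex.Isomorphic (BierChess.Complex.chessboardSelected m 2 (m - 2) R)
        (BierChess.Complex.sizeAtMost m 1).bier ∧
      (BierChess.Complex.sizeAtMost m 1).bier.HomeomorphicToUnitSphere (m - 1) ∧
      (BierChess.Complex.chessboardSelected m 2 (m - 2) R).HomeomorphicToUnitSphere (m - 1)) := by
  open BierChess.Complex in
  refine ⟨fun m p hp => ⟨homeomorphicToUnitSphere_bier_sizeAtMost hp,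
    isomorphic_bier_chessboard hp 0 rfl rfl, homeomorphicToUnitSphere_chessboard hp 0 rfl rfl⟩,
    fun p => ?_, fun m R hm hR => ?_⟩
  · have hp : p < 2 * p + 1 := by omega
    have hq : p = 2 * p + 1 - p - 1 := by omega
    exact ⟨(isomorphic_bier_chessboard hp 0 rfl hq).symm,
      homeomorphicToUnitSphere_bier_sizeAtMost hp, homeomorphicToUnitSphere_chessboard hp 0 rfl hq⟩
  · obtain ⟨r, rfl⟩ := Finset.card_eq_one.1 hR
    have hp : 1 < m := by omega
    -- In `Fin 2`, `r + 1` is the unselected row; with capacity 1 it carries the first copy of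
    -- `[m]`, and `r + 1 + 1 = r` carries the dual.
    have hi : (if r + 1 ∈ ({r} : Finset (Fin 2)) then m - 2 else 1) = 1 := by simp
    have hi' : (if r + 1 + 1 ∈ ({r} : Finset (Fin 2)) then m - 2 else 1) = m - 1 - 1 := by
      rw [if_pos (by fin_cases r <;> simp)]
      omega
    exact ⟨(isomorphic_bier_chessboard hp (r + 1) hi hi').symm,
      homeomorphicToUnitSphere_bier_sizeAtMost hp,
      homeomorphicToUnitSphere_chessboard hp (r + 1) hi hi'⟩
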